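/- Let $A$ be an alphabet (any set), $A^*$ the free monoid on $A$ and $\equiv$ a finitely generated congruence on $A^*$. For a semiring $K$, let $c:K\langle A\rangle\to K\langle A\rangle\otimes K\langle A\rangle$ be the coproduct dual to the shuffle product, i.e. the $K$-linear multiplicative map with $c(a)=a\otimes 1+1\otimes a$ for $a\in A$. The congruence $\equiv$ is called $K$-shuffle compatible if there is a (necessarily unique) $K$-linear map $c_\equiv:K[A^*/{\equiv}]\to K[A^*/{\equiv}]\otimes K[A^*/{\equiv}]$ with $c_\equiv\circ \mathrm{nat}=(\mathrm{nat}\otimes \mathrm{nat})\circ c$, where $\mathrm{nat}:K\langle A\rangle\to K[A^*/{\equiv}]$ is the canonical map; in this case, when $K$ is a ring, $P\in K[A^*/{\equiv}]$ is called primitive if $c_\equiv(P)=P\otimes 1+1\otimes P$. For $R\subseteq A^*\times A^*$, let $\equiv_R$ be the congruence generated by $R$. Then the following hold. 1. Let $K$ be a nonzero semiring such that $\equiv$ is $K$-shuffle compatible. If $K$ is not a ring, or if the characteristic of $K$ is not a prime number, then $A^*/{\equiv}$ is a partially commutative (trace) monoid, i.e. it is isomorphic to $\langle B;\ ab=ba\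 ((a,b)\in\theta)\rangle$ for some set $B$ and some symmetric irreflexive relation $\theta$ on $B$. 2. Let $K$ be a ring of prime characteristic $p$ such that $\equiv$ is $K$-shuffle compatible. Then there are a finite set $R\subseteq A^*\times A^*$ generating $\equiv$ (that is, ${\equiv_R}={\equiv}$) and a partition of $R$ into nonempty sets $R_1,\dots,R_n$ ($n\ge 0$) such that, for each $i\in\{1,\dots,n\}$, the congruence $\equiv_{R_1\cup\dots\cup R_{i-1}}$ is $K$-shuffle compatible and, for every $(u,v)\in R_i$, the image of $u-v$ in $K[A^*/{\equiv_{R_1\cup\dots\cup R_{i-1}}}]$ is primitive. -/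

import Mathlib

universe u v

namespace Shuffle

open MonoidAlgebra


/-- A semiring `K` is a ring: every element has an additive inverse. -/
def IsRing (K : Type v) [Semiring K] : Prop := ∀ x : K, ∃ y : K, x + y = 0

/-- The congruence on `A*` generated by a relator `R ⊆ A* × A*`. -/
def relatorCon {A : Type u} (R : Set (FreeMonoid A × FreeMonoid A)) : Con (FreeMonoid A) :=
  conGen fun x y => (x, y) ∈ R

/-- A congruence on `A*` is finitely generated if it is generated by a finite relator. -/
def IsFinitelyGenerated {A : Type u} (c : Con (FreeMonoid A)) : Prop :=
  ∃ R : Set (FreeMonoid A × FreeMonoid A), R.Finite ∧ relatorCon R = c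

/-- The free partially commutative monoid `M(B, θ)`, presented by the generators `B` and the
relations `ab = ba` for every edge `{a, b}` of the (unoriented, loopless) graph `θ`. -/
abbrev TraceMonoid (B : Type u) (θ : SimpleGraph B) : Type u :=
  PresentedMonoid fun x y : FreeMonoid B => ∃ a b : B, θ.Adj a b ∧
    x = FreeMonoid.of a * FreeMonoid.of b ∧ y = FreeMonoid.of b * FreeMonoid.of a

/-- A monoid is partially commutative if it is isomorphic to some `M(B, θ)`. -/
def IsPartiallyCommutative (M : Type u) [Monoid M] : Prop :=
  ∃ (B : Type u) (θ : SimpleGraph B), Nonempty (M ≃* TraceMonoid B θ)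

section Coproduct

variable (K : Type v) [Semiring K] {A : Type u}

/-- The coproduct `c` on words: the multiplicative map with `c(a) = a ⊗ 1 + 1 ⊗ a` on letters.
Here and below `K[M] ⊗ K[M]` is realised as the monoid algebra `K[M × M]`, the pair `(x, y)`
being the basis element `x ⊗ y`; for commutative `K` the identification with the tensor product
over `K` is `MonoidAlgebra.tensorEquiv`. This makes sense also when `K` is not commutative. -/
noncomputable def wordCoproduct :
    FreeMonoid A →* MonoidAlgebra K (FreeMonoid A × FreeMonoid A) :=
  FreeMonoid.lift fun a => single (FreeMonoid.of a, 1) 1 + single (1, FreeMonoid.of a) 1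

/-- The coproduct `c : K⟨A⟩ → K⟨A⟩ ⊗ K⟨A⟩` dual to the shuffle product: the `K`-linear
extension of `wordCoproduct`. -/
noncomputable def coproduct :
    MonoidAlgebra K (FreeMonoid A) →ₗ[K] MonoidAlgebra K (FreeMonoid A × FreeMonoid A) :=
  Finsupp.linearCombination K (wordCoproduct K) ∘ₗ (coeffLinearEquiv K).toLinearMap

/-- The canonical map `nat : K⟨A⟩ → K[A*/≡]`. -/
noncomputable def nat (c : Con (FreeMonoid A)) :
    MonoidAlgebra K (FreeMonoid A) →ₗ[K] MonoidAlgebra K c.Quotient :=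
  mapDomainLinearMap K K c.mk'

/-- The map `nat ⊗ nat : K⟨A⟩ ⊗ K⟨A⟩ → K[A*/≡] ⊗ K[A*/≡]`. -/
noncomputable def natTensorNat (c : Con (FreeMonoid A)) :
    MonoidAlgebra K (FreeMonoid A × FreeMonoid A) →ₗ[K]
      MonoidAlgebra K (c.Quotient × c.Quotient) :=
  mapDomainLinearMap K K (Prod.map c.mk' c.mk')

/-- `d` is a coproduct `c_≡` on `K[A*/≡]` making the square
`c_≡ ∘ nat = (nat ⊗ nat) ∘ c` commutative. It is unique if it exists, `nat` being onto. -/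
def IsQuotientCoproduct (c : Con (FreeMonoid A))
    (d : MonoidAlgebra K c.Quotient →ₗ[K] MonoidAlgebra K (c.Quotient × c.Quotient)) : Prop :=
  d ∘ₗ nat K c = natTensorNat K c ∘ₗ coproduct K

/-- The congruence `≡` is compatible with the shuffle product over `K`. -/
def IsShuffleCompatible (c : Con (FreeMonoid A)) : Prop :=
  ∃ d, IsQuotientCoproduct K c d

/-- `P ∈ K[A*/≡]` is primitive: `≡` is compatible with the shuffle product over `K`, and
`c_≡(P) = P ⊗ 1 + 1 ⊗ P`. -/
def IsPrimitive (c : Con (FreeMonoid A)) (P : MonoidAlgebra K c.Quotient) : Prop :=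
  ∃ d, IsQuotientCoproduct K c d ∧
    d P = mapDomain (fun x => (x, 1)) P + mapDomain (fun x => (1, x)) P

end Coproduct

/-- `R` is a finite relator generating `≡`, and the nonempty, pairwise disjoint sets
`S 0, …, S (n - 1)` with union `R` are such that, for every `i` and every `(x, y) ∈ S i`,
the image of `x - y` is primitive in `K[A*/≡']`, where `≡'` is generated by
`S 0 ∪ ⋯ ∪ S (i - 1)`. -/
structure IsPrimitivePartition (K : Type v) [Ring K] {A : Type u} (c : Con (FreeMonoid A))
    (R : Set (FreeMonoid A × FreeMonoid A)) {n : ℕ}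
    (S : Fin n → Set (FreeMonoid A × FreeMonoid A)) : Prop where
  finite : R.Finite
  generates : relatorCon R = c
  nonempty : ∀ i, (S i).Nonempty
  disjoint : ∀ i j, i ≠ j → Disjoint (S i) (S j)
  union : ⋃ i, S i = R
  primitive : ∀ i, ∀ x y, (x, y) ∈ S i →
    IsPrimitive K (relatorCon (⋃ j, ⋃ (_ : j < i), S j))
      (nat K _ (single x 1 - single y 1))

end Shuffle

namespace Shuffle

open MonoidAlgebra
open List (replicate)

/-! The coefficient of `X ⊗ Y` in the image of `c(w)` counts the ways to split `w` into
complementary subwords of classes `X` and `Y`. Compatibility therefore says that congruent words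
have equal splitting counts in `K`, for all `X` and `Y` (`coeff_quotientWordCoproduct`,
`isShuffleCompatible_iff`).

Claim 1. For each `n ≥ 2` some middle binomial coefficient of `n` is nonzero in `K`
(`hasMiddleChoose`), so splittings can be detected even in powers of one letter. Let `B` be the set
of nontrivial classes of letters. By induction on length, congruent words over `B` have equal
projections to every letter and to every noncommuting pair of letters (`traceEq_of_map_eq`): proper
splittings involve only shorter words, for which congruence is already trace equivalence. If a word
has letters inside and outside the chosen pair, splitting it along the pair isolates the projection.
Otherwise the proper shuffle coefficients of a word in two letters determine it, with `ab`, `ba` as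
the only exception (`eq_or_of_shuffleCount_eq`), and that exception means that `a` and `b` commute.
Equal projections imply equality in the trace monoid (`TraceEq.map_eq`).

Claim 2. Stratify `≡` by word length over the finitely many letters of a finite relator. If `x ≡ y`
have length at most `N + 1`, their proper subwords have length at most `N`, where `≡` and the
congruence generated by the pairs of length at most `N` coincide. Modulo the latter, the coproducts
of `x` and `y` thus differ only in the terms `x ⊗ 1 + 1 ⊗ x` and `y ⊗ 1 + 1 ⊗ y`
(`quotientWordCoproduct_add_eq`), which makes `x - y` primitive. In the next quotient these terms
agree, so it is compatible too. -/

section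

/-! ### Binomial coefficients in semirings -/

/-- For every `n ≥ 2`, some binomial coefficient `n.choose k` with `0 < k < n` is nonzero in `K`. -/
def HasMiddleChoose (K : Type v) [Semiring K] : Prop :=
  ∀ n, 2 ≤ n → ∃ k, 0 < k ∧ k < n ∧ ((n.choose k : ℕ) : K) ≠ 0

/-- If all middle coefficients of `n` vanish, then `n = 0` in `K`, so `n - 1` acts as `-1` and `K`
is a ring. Its characteristic divides their gcd, which is a prime if `n` is a power of that prime
and `1` otherwise. -/
theorem hasMiddleChoose {K : Type v} [Semiring K] [Nontrivial K]
    (h : ¬ IsRing K ∨ ¬ (ringChar K).Prime) : HasMiddleChoose K := by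
  intro n hn
  by_contra! H
  have hn0 : (n : K) = 0 := by simpa using H 1 one_pos hn
  have hring : IsRing K := by
    intro x
    refine ⟨((n - 1 : ℕ) : K) * x, ?_⟩
    have : ((1 + (n - 1) : ℕ) : K) = 0 := by rw [← hn0]; congr 1; omega
    rw [← one_mul x, ← mul_assoc, mul_one, ← add_mul]
    simp only [Nat.cast_add, Nat.cast_one] at this
    simp [this]
  have hdvd : ringChar K ∣ (Finset.Icc 1 (n - 1)).gcd n.choose := by
    refine Finset.dvd_gcd fun k hk => ?_
    rw [Finset.mem_Icc] at hk
    exact (ringChar.spec K _).1 (H k (by omega) (by omega))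
  have hne1 : ringChar K ≠ 1 := CharP.ringChar_ne_one
  refine h.elim (fun h => h hring) fun h => h ?_
  by_cases hp : IsPrimePow n
  · rw [Choose.gcd_choose_eq_minFac_of_isPrimePow hp] at hdvd
    have hmp := Nat.minFac_prime hp.ne_one
    rcases (Nat.dvd_prime hmp).1 hdvd with h1 | h1
    · exact absurd h1 hne1
    · rwa [h1]
  · rw [Choose.gcd_choose_eq_one_of_not_isPrimePow hn hp] at hdvd
    exact absurd (Nat.dvd_one.1 hdvd) hne1

/-! ### Splittings of words into complementary subwords -/

variable {α : Type*} {β : Type*}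

/-- The list of all pairs of complementary subwords of a word. -/
def splits : List α → List (List α × List α)
  | [] => [([], [])]
  | a :: l => (splits l).map (fun p => (a :: p.1, p.2)) ++
      (splits l).map (fun p => (p.1, a :: p.2))

theorem perm_of_mem_splits {l : List α} {p : List α × List α} (h : p ∈ splits l) :
    l.Perm (p.1 ++ p.2) := by
  induction l generalizing p with
  | nil => simp_all [splits]
  | cons a l ih =>
    simp only [splits, List.mem_append, List.mem_map] at h
    rcases h with ⟨q, hq, rfl⟩ | ⟨q, hq, rfl⟩
    · exact (ih hq).cons a
    · exact ((ih hq).cons a).trans List.perm_middle.symm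

theorem length_of_mem_splits {l : List α} {p : List α × List α} (h : p ∈ splits l) :
    p.1.length + p.2.length = l.length := by
  rw [(perm_of_mem_splits h).length_eq, List.length_append]

theorem subset_of_mem_splits {l : List α} {p : List α × List α} (h : p ∈ splits l) :
    (∀ a ∈ p.1, a ∈ l) ∧ ∀ a ∈ p.2, a ∈ l := by
  have := perm_of_mem_splits h
  exact ⟨fun a ha => this.mem_iff.2 (List.mem_append_left _ ha),
    fun a ha => this.mem_iff.2 (List.mem_append_right _ ha)⟩

theorem eq_filter_of_mem_splits (P : α → Bool) {l : List α} {p : List α × List α}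
    (h : p ∈ splits l) (h1 : ∀ a ∈ p.1, P a = true) (h2 : ∀ a ∈ p.2, P a = false) :
    p.1 = l.filter P ∧ p.2 = l.filter (fun a => !P a) := by
  induction l generalizing p with
  | nil => simp_all [splits]
  | cons a l ih =>
    simp only [splits, List.mem_append, List.mem_map] at h
    rcases h with ⟨q, hq, rfl⟩ | ⟨q, hq, rfl⟩
    · have ha := h1 a (by simp)
      have := ih hq (fun b hb => h1 b (by simp [hb])) h2
      simp [ha, this.1, this.2]
    · have ha := h2 a (by simp)
      have := ih hq h1 (fun b hb => h2 b (by simp [hb]))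
      simp [ha, this.1, this.2]

theorem splits_map (f : α → β) (l : List α) :
    splits (l.map f) = (splits l).map (fun p => (p.1.map f, p.2.map f)) := by
  induction l with
  | nil => rfl
  | cons a l ih => simp [splits, ih, Function.comp_def]

open Classical in
/-- The number of splittings of a word into a subword satisfying `P` whose complement
satisfies `Q`. -/
noncomputable def splitCount (P Q : List α → Prop) (l : List α) : ℕ :=
  (splits l).countP fun p => P p.1 ∧ Q p.2

theorem splitCount_cons (P Q : List α → Prop) (a : α) (l : List α) :
    splitCount P Q (a :: l) =
      splitCount (fun x => P (a :: x)) Q l + splitCount P (fun y => Q (a :: y)) l := by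
  simp [splitCount, splits, List.countP_map, Function.comp_def]

theorem splitCount_nil_of (P Q : List α → Prop) (h : P [] ∧ Q []) : splitCount P Q [] = 1 := by
  simp [splitCount, splits, h]

theorem splitCount_congr {P Q P' Q' : List α → Prop} {l : List α}
    (h : ∀ p ∈ splits l, (P p.1 ∧ Q p.2 ↔ P' p.1 ∧ Q' p.2)) :
    splitCount P Q l = splitCount P' Q' l := by
  unfold splitCount
  refine List.countP_congr fun p hp => ?_
  simpa using h p hp

theorem splitCount_eq_zero {P Q : List α → Prop} {l : List α}
    (h : ∀ p ∈ splits l, P p.1 → ¬ Q p.2) : splitCount P Q l = 0 := by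
  unfold splitCount
  rw [List.countP_eq_zero]
  intro p hp
  simpa using h p hp

theorem exists_of_splitCount_ne_zero {P Q : List α → Prop} {l : List α}
    (h : splitCount P Q l ≠ 0) : ∃ p ∈ splits l, P p.1 ∧ Q p.2 := by
  by_contra! H
  exact h (splitCount_eq_zero H)

theorem splitCount_filter (P : α → Bool) (l : List α) :
    splitCount (· = l.filter P) (· = l.filter (fun a => !P a)) l = 1 := by
  induction l with
  | nil => exact splitCount_nil_of _ _ (by simp)
  | cons a l ih =>
    rw [splitCount_cons]
    by_cases ha : P a = true
    · simp only [ha, List.filter_cons_of_pos, List.cons.injEq, true_and, Bool.not_true,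
        Bool.false_eq_true, not_false_eq_true, List.filter_cons_of_neg]
      rw [ih, splitCount_eq_zero]
      intro p _ _ h2
      have : a ∈ l.filter (fun a => !P a) := by rw [← h2]; simp
      simp [ha] at this
    · rw [Bool.not_eq_true] at ha
      have h1 : (a :: l).filter P = l.filter P := by simp [ha]
      have h2 : (a :: l).filter (fun a => !P a) = a :: l.filter (fun a => !P a) := by simp [ha]
      simp only [h1, h2, List.cons.injEq, true_and]
      rw [ih, splitCount_eq_zero]
      intro p _ h1
      have : a ∈ l.filter P := by rw [← h1]; simp
      simp [ha] at this

/-- If `P` and `Q` only hold for words of `P₀`-letters, respectively of letters outside `P₀`,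
then only one splitting counts. -/
theorem splitCount_eq_one {P Q : List α → Prop} (P₀ : α → Bool) {l : List α}
    (h1 : P (l.filter P₀)) (h2 : Q (l.filter fun a => !P₀ a))
    (hP : ∀ x, P x → ∀ a ∈ x, P₀ a = true) (hQ : ∀ x, Q x → ∀ a ∈ x, P₀ a = false) :
    splitCount P Q l = 1 := by
  rw [← splitCount_filter P₀ l]
  refine splitCount_congr fun p hp => ⟨fun h => ?_, fun h => ?_⟩
  · exact eq_filter_of_mem_splits P₀ hp (hP _ h.1) (hQ _ h.2)
  · rw [h.1, h.2]; exact ⟨h1, h2⟩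

/-! ### Counting splittings of words in two letters -/

/-- The number of ways to split `l` as a shuffle of `x` and `y`. -/
noncomputable def shuffleCount (x y l : List α) : ℕ := splitCount (· = x) (· = y) l

theorem shuffleCount_filter (P : α → Bool) (l : List α) :
    shuffleCount (l.filter P) (l.filter fun a => !P a) l = 1 := splitCount_filter P l

theorem shuffleCount_cons_both (a : α) (x y l : List α) :
    shuffleCount (a :: x) (a :: y) (a :: l) =
      shuffleCount x (a :: y) l + shuffleCount (a :: x) y l := by
  simp [shuffleCount, splitCount_cons]

theorem shuffleCount_cons_left {a : α} {y : List α} (hy : ∀ y', y ≠ a :: y') (x l : List α) :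
    shuffleCount (a :: x) y (a :: l) = shuffleCount x y l := by
  have : splitCount (· = a :: x) (fun z => a :: z = y) l = 0 :=
    splitCount_eq_zero fun p _ _ h => hy _ h.symm
  simp [shuffleCount, splitCount_cons, this]

theorem shuffleCount_cons_right {a : α} {x : List α} (hx : ∀ x', x ≠ a :: x') (y l : List α) :
    shuffleCount x (a :: y) (a :: l) = shuffleCount x y l := by
  have : splitCount (fun z => a :: z = x) (· = a :: y) l = 0 :=
    splitCount_eq_zero fun p _ h => absurd h.symm (hx _)
  simp [shuffleCount, splitCount_cons, this]

theorem shuffleCount_cons_neither {a : α} {x y : List α} (hx : ∀ x', x ≠ a :: x')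
    (hy : ∀ y', y ≠ a :: y') (l : List α) : shuffleCount x y (a :: l) = 0 := by
  have h1 : splitCount (fun z => a :: z = x) (· = y) l = 0 :=
    splitCount_eq_zero fun p _ h => absurd h.symm (hx _)
  have h2 : splitCount (· = x) (fun z => a :: z = y) l = 0 :=
    splitCount_eq_zero fun p _ _ h => hy _ h.symm
  simp [shuffleCount, splitCount_cons, h1, h2]

theorem shuffleCount_nil_left (y : List α) : shuffleCount [] y y = 1 := by
  simpa using shuffleCount_filter (fun _ => false) y

theorem shuffleCount_replicate_append (a : α) (i : ℕ) {w : List α} (hw : ∀ w', w ≠ a :: w') :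
    shuffleCount (replicate i a) w (replicate i a ++ w) = 1 := by
  induction i with
  | zero => simpa using shuffleCount_nil_left w
  | succ i ih =>
    rw [List.replicate_succ, List.cons_append, shuffleCount_cons_left hw, ih]

theorem replicate_ne_cons {a b : α} (hab : a ≠ b) (n : ℕ) (l : List α) :
    replicate n a ≠ b :: l := by
  cases n with
  | zero => simp
  | succ n => simp [List.replicate_succ, hab]

/-- The first `b` of the target has to come from the second word, where at least `j` letters `a`
precede it, but the target offers only `i < j`. -/
theorem shuffleCount_replicate_eq_zero {a b : α} (hab : a ≠ b) {i j : ℕ} (hij : i < j) (m : ℕ)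
    (z r : List α) :
    shuffleCount (replicate m a) (replicate j a ++ z) (replicate i a ++ b :: r) = 0 := by
  induction i generalizing j m with
  | zero =>
    obtain ⟨j, rfl⟩ := Nat.exists_eq_succ_of_ne_zero hij.ne'
    exact shuffleCount_cons_neither (replicate_ne_cons hab m) (by simp [List.replicate_succ, hab]) r
  | succ i ih =>
    obtain ⟨j, rfl⟩ := Nat.exists_eq_succ_of_ne_zero (Nat.ne_zero_of_lt hij)
    simp only [Nat.succ_eq_add_one, List.replicate_succ, List.cons_append]
    cases m with
    | zero =>
      rw [List.replicate_zero, shuffleCount_cons_right (by simp)]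
      exact ih (by omega) 0
    | succ m =>
      rw [List.replicate_succ, shuffleCount_cons_both]
      have h1 := ih (j := j + 1) (by omega) m
      have h2 := ih (j := j) (by omega) (m + 1)
      simp only [List.replicate_succ, List.cons_append] at h1 h2
      rw [h1, h2]

/-- Removing from `a ^ i b r` all letters `a` of `r`. -/
theorem shuffleCount_replicate_tail {a b : α} (hab : a ≠ b) (i m : ℕ) {L : ℕ} {r : List α}
    (h : shuffleCount (replicate m a) (replicate L b) r = 1) :
    shuffleCount (replicate m a) (replicate i a ++ replicate (L + 1) b)
      (replicate i a ++ b :: r) = 1 := by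
  induction i with
  | zero =>
    simpa [List.replicate_succ] using
      (shuffleCount_cons_right (replicate_ne_cons hab m) (replicate L b) r).trans h
  | succ i ih =>
    simp only [List.replicate_succ (n := i), List.cons_append]
    cases m with
    | zero => rw [List.replicate_zero, shuffleCount_cons_right (by simp)]; exact ih
    | succ m =>
      rw [List.replicate_succ (n := m), shuffleCount_cons_both]
      -- Taking the leading `a` from the first word would leave the second with more leading letters
      -- `a` than the rest of the target has, so this branch contributes nothing.
      have h1 := shuffleCount_replicate_eq_zero hab (Nat.lt_succ_self i) m (replicate (L + 1) b) r
      simp only [Nat.succ_eq_add_one, List.replicate_succ (n := i), List.cons_append] at h1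
      rw [h1, zero_add]
      exact ih

/-- Peeling off the leading `a` gives Pascal's rule; the condition on `w` handles the boundary `j =
0`. -/
theorem shuffleCount_replicate_choose {a : α} {w : List α} (hw : ∀ w', w ≠ a :: w') (k j : ℕ) :
    shuffleCount (replicate k a) (replicate j a ++ w) (replicate (k + j) a ++ w) =
      (k + j).choose k := by
  induction k generalizing j with
  | zero => simpa using shuffleCount_nil_left _
  | succ k ih =>
    induction j with
    | zero => simpa using shuffleCount_replicate_append a (k + 1) hw
    | succ j ihj =>
      rw [show k + 1 + (j + 1) = (k + (j + 1)) + 1 by omega, List.replicate_succ (n := k + (j + 1)),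
        List.replicate_succ (n := k), List.replicate_succ (n := j)]
      simp only [List.cons_append]
      rw [shuffleCount_cons_both, Nat.choose_succ_succ, ← ih (j + 1),
        show k + (j + 1) = k + 1 + j by omega, ← ihj]
      simp only [List.replicate_succ, List.cons_append]

end

/-! ### Words in two letters are determined by their proper shuffle coefficients -/

section

variable {α : Type*} {K : Type v} [Semiring K]

theorem exists_eq_replicate_append_cons {a b : α} {u : List α} (h : ∀ c ∈ u, c = a ∨ c = b)
    (hb : b ∈ u) : ∃ i r, u = replicate i a ++ b :: r := by
  induction u with
  | nil => simp at hb
  | cons c u ih =>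
    rcases eq_or_ne c b with rfl | hcb
    · exact ⟨0, u, rfl⟩
    · have hca : c = a := (h c (by simp)).resolve_right hcb
      subst hca
      obtain ⟨i, r, hr⟩ := ih (fun d hd => h d (by simp [hd]))
        (by simpa [hcb.symm] using hb)
      exact ⟨i + 1, r, by rw [List.replicate_succ, List.cons_append, ← hr]⟩

/-- As `b :: r` cannot supply a leading `a`, the whole prefix `a ^ n` comes from `a ^ m`. If that
exhausts it, the rest of the target is the second word. -/
theorem le_of_shuffleCount_replicate_ne_zero {a b : α} (hab : a ≠ b) {m n : ℕ} {r s : List α}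
    (h : shuffleCount (replicate m a) (b :: r) (replicate n a ++ b :: s) ≠ 0) :
    n ≤ m ∧ (n = m → r = s) := by
  induction n generalizing m with
  | zero =>
    refine ⟨Nat.zero_le m, ?_⟩
    rintro rfl
    obtain ⟨p, hp, h1, h2⟩ := exists_of_splitCount_ne_zero h
    have := perm_of_mem_splits hp
    by_contra hrs
    have hp' := eq_filter_of_mem_splits (fun _ => false) hp (by simp [h1]) (by simp)
    simp only [List.replicate_zero, List.nil_append] at hp'
    have h3 := hp'.2
    simp only [h2, Bool.not_false, List.filter_true, List.cons.injEq, true_and] at h3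
    exact hrs h3
  | succ n ih =>
    rw [List.replicate_succ, List.cons_append] at h
    cases m with
    | zero => exact absurd (shuffleCount_cons_neither (by simp) (by simp [hab.symm]) _) h
    | succ m =>
      rw [List.replicate_succ, shuffleCount_cons_left (by simp [hab.symm])] at h
      have := ih h
      exact ⟨by omega, fun h => this.2 (by omega)⟩

/-- A word starting with `a` is of the form `a b ⋯ b` if no shuffle of two words not starting
with `b` involves it with a nonzero coefficient. -/
theorem eq_cons_replicate_of_shuffleCount_eq_zero [Nontrivial K] (hK : HasMiddleChoose K)
    {a b : α} (hab : a ≠ b) {u : List α} (hu : ∀ c ∈ u, c = a ∨ c = b) (hb : b ∈ u)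
    (ha : ∀ r, u ≠ b :: r)
    (h : ∀ x y : List α, x ≠ [] → y ≠ [] → x.length + y.length = u.length →
      (∀ x', x ≠ b :: x') → (∀ y', y ≠ b :: y') → ((shuffleCount x y u : ℕ) : K) = 0) :
    ∃ l, u = a :: replicate (l + 1) b := by
  classical
  obtain ⟨i, r, rfl⟩ := exists_eq_replicate_append_cons hu hb
  obtain ⟨i, rfl⟩ : ∃ j, i = j + 1 := by
    refine Nat.exists_eq_succ_of_ne_zero ?_
    rintro rfl
    exact ha r rfl
  have hr : ∀ c ∈ r, c = a ∨ c = b := fun c hc => hu c (by simp [hc])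
  -- Otherwise the letters `a` of `r` form one word and what remains, `a ^ (i + 1) b ⋯ b`, the
  -- other. Both start with `a`, and the coefficient is 1.
  have har : a ∉ r := by
    intro har
    have h1 : r.filter (fun c => decide (c = a)) = replicate (r.count a) a := by
      have := List.filter_beq (l := r) a
      simpa [beq_eq_decide] using this
    have h2 : r.filter (fun c => !decide (c = a)) =
        replicate (r.filter (fun c => !decide (c = a))).length b := by
      refine List.eq_replicate_of_mem fun c hc => ?_
      simp only [List.mem_filter, Bool.not_eq_eq_eq_not, Bool.not_true,
        decide_eq_false_iff_not] at hc
      exact (hr c hc.1).resolve_left hc.2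
    have h3 := shuffleCount_filter (fun c => decide (c = a)) r
    have hlen := length_of_mem_splits (exists_of_splitCount_ne_zero
      (h3.trans_ne one_ne_zero)).choose_spec.1
    obtain ⟨e1, e2⟩ := (exists_of_splitCount_ne_zero (h3.trans_ne one_ne_zero)).choose_spec.2
    rw [e1, e2] at hlen
    rw [h1, h2] at h3
    rw [h1, List.length_replicate] at hlen
    have h4 := shuffleCount_replicate_tail hab (i + 1) _ h3
    have hpos : 0 < r.count a := List.count_pos_iff.2 har
    have := h (replicate (r.count a) a)
      (replicate (i + 1) a ++ replicate ((r.filter (fun c => !decide (c = a))).length + 1) b)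
      (by simp; omega) (by simp)
      (by simp; omega)
      (replicate_ne_cons hab _) (by simp [List.replicate_succ, hab])
    rw [h4] at this
    simp at this
  have hrb : r = replicate r.length b :=
    List.eq_replicate_of_mem fun c hc => (hr c hc).resolve_left (by rintro rfl; exact har hc)
  rw [hrb, ← List.replicate_succ] at h ⊢
  refine ⟨r.length, ?_⟩
  suffices i = 0 by subst this; rfl
  by_contra hi
  -- Splitting `a ^ (i + 1) b ⋯ b` into `a ^ k` and the rest has coefficient `(i + 1).choose k`.
  obtain ⟨k, hk0, hk, hne⟩ := hK (i + 1) (by omega)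
  refine hne ?_
  obtain ⟨j, hj⟩ : ∃ j, i + 1 = k + (j + 1) := ⟨i - k, by omega⟩
  rw [hj] at h ⊢
  rw [← shuffleCount_replicate_choose (replicate_ne_cons hab.symm (r.length + 1)) k (j + 1)]
  refine h _ _ (by simp; omega) (by simp) (by simp; omega)
    (replicate_ne_cons hab _) (by simp [List.replicate_succ, hab])

/-- The shuffle of the initial power of `a` with the remaining word, taken from either side, has
coefficient 1 there and hence a nonzero one in the other word. This bounds each exponent by the
other. -/
theorem eq_of_shuffleCount_eq_of_replicate [Nontrivial K] {a b : α} (hab : a ≠ b)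
    {i j : ℕ} {r s : List α} (hlen : i + r.length = j + s.length)
    (h : ∀ x y : List α, x ≠ [] → y ≠ [] → x.length + y.length = i + r.length + 2 →
      ((shuffleCount x y (replicate (i + 1) a ++ b :: r) : ℕ) : K) =
        (shuffleCount x y (replicate (j + 1) a ++ b :: s) : ℕ)) :
    i = j ∧ r = s := by
  have h1 := h (replicate (i + 1) a) (b :: r) (by simp) (by simp) (by simp; omega)
  have h2 := h (replicate (j + 1) a) (b :: s) (by simp) (by simp) (by simp; omega)
  rw [shuffleCount_replicate_append _ _ (by simp [hab.symm])] at h1 h2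
  have h1' := le_of_shuffleCount_replicate_ne_zero hab
    (fun h0 => by rw [h0] at h1; simp at h1)
  have h2' := le_of_shuffleCount_replicate_ne_zero hab
    (fun h0 => by rw [h0] at h2; simp at h2)
  have hij : i = j := by omega
  exact ⟨hij, h1'.2 (by omega)⟩

/-- If two words in the letters `a` and `b` have the same coefficients in all proper shuffles,
then they are equal or they are `ab` and `ba`. -/
theorem eq_or_of_shuffleCount_eq [Nontrivial K] (hK : HasMiddleChoose K) {a b : α} (hab : a ≠ b)
    {u v : List α} (hu : ∀ c ∈ u, c = a ∨ c = b) (huv : u.Perm v)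
    (h : ∀ x y : List α, x ≠ [] → y ≠ [] → x.length + y.length = u.length →
      ((shuffleCount x y u : ℕ) : K) = (shuffleCount x y v : ℕ)) :
    u = v ∨ (u = [a, b] ∧ v = [b, a]) ∨ (u = [b, a] ∧ v = [a, b]) := by
  have hv : ∀ c ∈ v, c = a ∨ c = b := fun c hc => hu c (huv.mem_iff.2 hc)
  have key : ∀ (a b : α), a ≠ b → ∀ u v : List α, (∀ c ∈ u, c = a ∨ c = b) →
      (∀ c ∈ v, c = a ∨ c = b) → u.Perm v → a ∈ u → b ∈ u →
      (∀ x y : List α, x ≠ [] → y ≠ [] → x.length + y.length = u.length →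
      ((shuffleCount x y u : ℕ) : K) = (shuffleCount x y v : ℕ)) → (∃ r, u = a :: r) →
      u = v ∨ (u = [a, b] ∧ v = [b, a]) := by
    clear! u v a b
    rintro a b hab u v hu hv huv ha hb h ⟨u', hu'⟩
    obtain ⟨i, r, hi⟩ := exists_eq_replicate_append_cons hu hb
    obtain ⟨j, s, hj⟩ := exists_eq_replicate_append_cons hv (huv.mem_iff.1 hb)
    obtain ⟨i, rfl⟩ : ∃ i', i = i' + 1 := by
      refine Nat.exists_eq_succ_of_ne_zero ?_
      rintro rfl
      simp [hu', hab] at hi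
    rcases j with _ | j
    · right
      -- Here `v` starts with `b`, so shuffles of words not starting with `b` miss `v` and hence
      -- `u`. The same with the roles exchanged shapes `v`, and counting letters leaves `ab` and
      -- `ba`.
      have e1 : ∃ l, u = a :: replicate (l + 1) b := by
        refine eq_cons_replicate_of_shuffleCount_eq_zero hK hab hu hb (by simp [hu', hab]) ?_
        intro x y hx hy hxy hx' hy'
        rw [h x y hx hy hxy, hj, List.replicate_zero, List.nil_append,
          shuffleCount_cons_neither hx' hy', Nat.cast_zero]
      have e2 : ∃ l, v = b :: replicate (l + 1) a := by
        refine eq_cons_replicate_of_shuffleCount_eq_zero hK hab.symm (fun c hc => (hv c hc).symm)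
          (huv.mem_iff.1 ha) (by simp [hj, hab.symm]) ?_
        intro x y hx hy hxy hx' hy'
        rw [← h x y hx hy (by rw [hxy, huv.length_eq]), hu',
          shuffleCount_cons_neither hx' hy', Nat.cast_zero]
      obtain ⟨l, hl⟩ := e1
      obtain ⟨l', hl'⟩ := e2
      classical
      have c1 := huv.count_eq a
      have c2 := huv.count_eq b
      simp only [hl, hl', List.count_cons, List.count_replicate] at c1 c2
      simp only [beq_iff_eq, hab, hab.symm, beq_self_eq_true, if_true, if_false] at c1 c2
      obtain rfl : l = 0 := by omega
      obtain rfl : l' = 0 := by omega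
      exact ⟨hl, hl'⟩
    · left
      have hlen := huv.length_eq
      rw [hi, hj] at hlen
      simp only [List.length_append, List.length_replicate, List.length_cons] at hlen
      obtain ⟨rfl, rfl⟩ := eq_of_shuffleCount_eq_of_replicate (K := K) hab (i := i) (j := j)
        (r := r) (s := s) (by omega) (by
          intro x y hx hy hxy
          rw [← hi, ← hj]
          exact h x y hx hy (by rw [hi]; simp; omega))
      rw [hi, hj]
  by_cases ha : a ∈ u
  · by_cases hb : b ∈ u
    · obtain ⟨c, r, hc⟩ := List.exists_cons_of_ne_nil (List.ne_nil_of_mem ha)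
      rcases hu c (by simp [hc]) with rfl | rfl
      · exact (key c b hab u v hu hv huv ha hb h ⟨r, hc⟩).imp_right Or.inl
      · exact (key c a hab.symm u v (fun d hd => (hu d hd).symm) (fun d hd => (hv d hd).symm) huv
          hb ha h ⟨r, hc⟩).imp_right Or.inr
    · left
      have h1 : u = replicate u.length a := List.eq_replicate_of_mem fun c hc =>
        (hu c hc).resolve_right (by rintro rfl; exact hb hc)
      rw [h1] at huv ⊢
      exact List.replicate_perm.1 huv
  · left
    have h1 : u = replicate u.length b := List.eq_replicate_of_mem fun c hc =>
      (hu c hc).resolve_left (by rintro rfl; exact ha hc)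
    rw [h1] at huv ⊢
    exact List.replicate_perm.1 huv

/-! ### Trace equivalence of words through projections to pairs of letters -/

open Classical in
/-- Two words are trace equivalent with respect to a commutation relation if their projections to
all single letters and to all pairs of noncommuting letters agree. -/
def TraceEq (comm : α → α → Prop) (u v : List α) : Prop :=
  ∀ a b, (a = b ∨ ¬ comm a b) →
    u.filter (fun c => decide (c = a ∨ c = b)) = v.filter (fun c => decide (c = a ∨ c = b))

variable {comm : α → α → Prop} {u v w : List α}

theorem TraceEq.refl (u : List α) : TraceEq comm u u := fun _ _ _ => rfl

theorem TraceEq.symm (h : TraceEq comm u v) : TraceEq comm v u := fun a b hab => (h a b hab).symm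

theorem TraceEq.perm (h : TraceEq comm u v) : u.Perm v := by
  classical
  rw [List.perm_iff_count]
  intro a
  have h1 := congrArg List.length (h a a (Or.inl rfl))
  simp only [or_self] at h1
  rw [← List.countP_eq_length_filter, ← List.countP_eq_length_filter] at h1
  simpa [List.count, beq_eq_decide] using h1

theorem TraceEq.eq_of_pair {a b : α} (hab : a = b ∨ ¬ comm a b) (hv : ∀ c ∈ v, c = a ∨ c = b)
    (h : TraceEq comm u v) : u = v := by
  have hu : ∀ c ∈ u, c = a ∨ c = b := fun c hc => hv c (h.perm.mem_iff.1 hc)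
  have := h a b hab
  rwa [List.filter_eq_self.2 (by simpa using hu), List.filter_eq_self.2 (by simpa using hv)] at this

theorem map_ofList_commute {N : Type*} [Monoid N] (f : FreeMonoid α →* N) {a : α}
    (h : ∀ b ∈ u, f (.of a) * f (.of b) = f (.of b) * f (.of a)) :
    f (.of a) * f (FreeMonoid.ofList u) = f (FreeMonoid.ofList u) * f (.of a) := by
  induction u with
  | nil => simp
  | cons c u ih =>
    have h1 := h c (by simp)
    have h2 := ih fun b hb => h b (by simp [hb])
    rw [FreeMonoid.ofList_cons, map_mul, ← mul_assoc, h1, mul_assoc, h2, mul_assoc]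

/-- The first letter `a` of `u` commutes with everything before its first occurrence in `v`: a
noncommuting `b` there would make the projections to `{a, b}` start differently. So `a` can be moved
to the front of `v` and cancelled. -/
theorem TraceEq.map_eq {N : Type*} [Monoid N] (f : FreeMonoid α →* N)
    (hsymm : ∀ a b, comm a b → comm b a)
    (hf : ∀ a b, comm a b → f (.of a) * f (.of b) = f (.of b) * f (.of a))
    (h : TraceEq comm u v) : f (FreeMonoid.ofList u) = f (FreeMonoid.ofList v) := by
  classical
  induction u generalizing v with
  | nil => rw [List.nil_perm.1 h.perm]
  | cons a u ih =>
    obtain ⟨s, t, rfl, has⟩ := List.eq_append_cons_of_mem (h.perm.mem_iff.1 List.mem_cons_self)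
    have hc : ∀ b ∈ s, comm a b := by
      intro b hb
      by_contra hab
      have h1 := h a b (Or.inr hab)
      have hbs : b ∈ s.filter (fun c => decide (c = a ∨ c = b)) := by simp [hb]
      rw [List.filter_append] at h1
      obtain ⟨d, q, hd⟩ := List.exists_cons_of_ne_nil (List.ne_nil_of_mem hbs)
      have hds : d ∈ s := (List.mem_filter.1 (hd ▸ List.mem_cons_self :
        d ∈ s.filter (fun c => decide (c = a ∨ c = b)))).1
      rw [hd] at h1
      simp only [true_or, decide_true, List.filter_cons_of_pos, List.cons_append,
        List.cons.injEq] at h1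
      exact has (h1.1 ▸ hds)
    have hst : TraceEq comm u (s ++ t) := by
      intro x y hxy
      have h1 := h x y hxy
      rw [List.filter_append] at h1 ⊢
      by_cases ha : a = x ∨ a = y
      · have hs : s.filter (fun c => decide (c = x ∨ c = y)) = [] := by
          rw [List.filter_eq_nil_iff]
          intro b hb
          have hba : b ≠ a := by rintro rfl; exact has hb
          simp only [decide_eq_true_eq]
          rintro hb'
          have := hc b hb
          grind
        rw [hs, List.nil_append] at h1 ⊢
        simpa [List.filter_cons, ha] using h1
      · simpa [List.filter_cons, ha] using h1
    have h2 := ih hst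
    rw [FreeMonoid.ofList_cons, map_mul, h2]
    have h3 := map_ofList_commute f fun b hb => hf a b (hc b hb)
    rw [FreeMonoid.ofList_append, FreeMonoid.ofList_append, FreeMonoid.ofList_cons, map_mul,
      map_mul, map_mul, ← mul_assoc, h3, mul_assoc]

end

/-! ### Recovering the trace class from proper splittings -/

section

variable {α : Type*} {K : Type v} [Semiring K]
variable {comm : α → α → Prop} {u v : List α}

/-- Words of length at least two have a nonzero coefficient in some proper shuffle. -/
theorem exists_splitCount_traceEq_ne_zero [Nontrivial K] (hK : HasMiddleChoose K)
    (hu : 2 ≤ u.length) : ∃ x y : List α, x ≠ [] ∧ y ≠ [] ∧ u.Perm (x ++ y) ∧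
      ((splitCount (TraceEq comm · x) (TraceEq comm · y) u : ℕ) : K) ≠ 0 := by
  classical
  obtain ⟨a, u', rfl⟩ := List.exists_cons_of_ne_nil (l := u) (by rintro rfl; simp at hu)
  -- Separating `a` from the other letters gives exactly one splitting; only powers of a single
  -- letter need a nonzero binomial coefficient.
  by_cases h : ∃ b ∈ u', b ≠ a
  · obtain ⟨b, hb, hba⟩ := h
    refine ⟨(a :: u').filter (fun c => decide (c = a)), (a :: u').filter (fun c => !decide (c = a)),
      by simp, List.ne_nil_of_mem (a := b) (by simp [hb, hba]),
      (List.filter_append_perm _ _).symm, ?_⟩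
    rw [splitCount_eq_one (P := (TraceEq comm · _)) (Q := (TraceEq comm · _))
      (fun c => decide (c = a)) (TraceEq.refl _) (TraceEq.refl _)]
    · simp
    · intro x hx c hc
      exact (List.mem_filter.1 (hx.perm.mem_iff.1 hc)).2
    · intro x hx c hc
      simpa using (List.mem_filter.1 (hx.perm.mem_iff.1 hc)).2
  · push Not at h
    have hrep : u' = replicate u'.length a := List.eq_replicate_of_mem h
    generalize u'.length = n at hrep
    subst hrep
    simp only [List.length_cons, List.length_replicate] at hu
    obtain ⟨k, hk0, hk, hne⟩ := hK (n + 1) hu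
    obtain ⟨j, hj⟩ : ∃ j, n + 1 = k + j := ⟨n + 1 - k, by omega⟩
    refine ⟨replicate k a, replicate j a, by simp; omega, by simp; omega, ?_, ?_⟩
    · rw [← List.replicate_succ, hj, List.replicate_append_replicate]
    · rw [hj] at hne
      rw [← List.replicate_succ, hj]
      have e : ∀ m (x : List α), TraceEq comm x (replicate m a) ↔ x = replicate m a := fun m x =>
        ⟨fun h => h.eq_of_pair (Or.inl rfl) (a := a) (b := a) (by simp +contextual),
          fun h => h ▸ TraceEq.refl _⟩
      simp only [e]
      have := shuffleCount_replicate_choose (a := a) (w := []) (by simp) k j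
      rw [shuffleCount, List.append_nil, List.append_nil] at this
      rwa [this]

/-- Words that have the same coefficients in all proper shuffles, up to trace equivalence, are
trace equivalent, unless they are `ab` and `ba`. -/
theorem traceEq_of_splitCount_eq [Nontrivial K] (hK : HasMiddleChoose K)
    (hu : 2 ≤ u.length)
    (hcomm : ∀ a b, (u = [a, b] ∧ v = [b, a]) → comm a b ∧ comm b a)
    (h : ∀ x y : List α, x ≠ [] → y ≠ [] → x.length + y.length = u.length →
      ((splitCount (TraceEq comm · x) (TraceEq comm · y) u : ℕ) : K) =
        (splitCount (TraceEq comm · x) (TraceEq comm · y) v : ℕ)) :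
    TraceEq comm u v := by
  classical
  have huv : u.Perm v := by
    obtain ⟨x, y, hx, hy, hp, hne⟩ := exists_splitCount_traceEq_ne_zero (comm := comm) hK hu
    rw [h x y hx hy (by rw [hp.length_eq, List.length_append])] at hne
    obtain ⟨p, hpv, h1, h2⟩ := exists_of_splitCount_ne_zero
      (fun h0 => hne (by rw [h0, Nat.cast_zero]))
    exact hp.trans ((h1.perm.append h2.perm).symm.trans (perm_of_mem_splits hpv).symm)
  intro a b hab
  set P : α → Bool := fun c => decide (c = a ∨ c = b) with hP
  by_cases hx : u.filter P = []
  · have := huv.filter P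
    rw [hx] at this ⊢
    exact (List.nil_perm.1 this).symm
  -- If all letters lie in `{a, b}`, trace equivalence to a word in `a` and `b` is equality, and the
  -- two-letter result applies.
  by_cases hy : u.filter (fun c => !P c) = []
  · have hu' : ∀ c ∈ u, c = a ∨ c = b := by
      intro c hc
      have := List.filter_eq_nil_iff.1 hy c hc
      simpa [hP, or_iff_not_imp_left] using this
    have hv' : ∀ c ∈ v, c = a ∨ c = b := fun c hc => hu' c (huv.mem_iff.2 hc)
    rw [List.filter_eq_self.2 (by simpa [hP] using hu'),
      List.filter_eq_self.2 (by simpa [hP] using hv')]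
    rcases eq_or_ne a b with rfl | hne
    · have h1 : u = replicate u.length a := List.eq_replicate_of_mem (by simpa using hu')
      have h2 : v = replicate v.length a := List.eq_replicate_of_mem (by simpa using hv')
      rw [h1, h2, huv.length_eq]
    have hnc := hab.resolve_left hne
    have key : ∀ x y : List α, ∀ w : List α, w.Perm u → x ≠ [] → y ≠ [] →
        x.length + y.length = u.length → (∀ c ∈ x ++ y, c = a ∨ c = b) →
        splitCount (TraceEq comm · x) (TraceEq comm · y) w = shuffleCount x y w := by
      intro x y w hw hx hy hxy hc
      refine splitCount_congr fun p hp => ⟨fun h => ⟨?_, ?_⟩, fun h => ?_⟩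
      · exact h.1.eq_of_pair hab fun c hcx => hc c (by simp [hcx])
      · exact h.2.eq_of_pair hab fun c hcx => hc c (by simp [hcx])
      · rw [h.1, h.2]; exact ⟨TraceEq.refl _, TraceEq.refl _⟩
    have hsh : ∀ x y : List α, x ≠ [] → y ≠ [] → x.length + y.length = u.length →
        ((shuffleCount x y u : ℕ) : K) = (shuffleCount x y v : ℕ) := by
      intro x y hx hy hxy
      by_cases hc : ∀ c ∈ x ++ y, c = a ∨ c = b
      · rw [← key x y u (.refl _) hx hy hxy hc, ← key x y v huv.symm hx hy hxy hc]
        exact h x y hx hy hxy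
      · have zero : ∀ w : List α, w.Perm u → shuffleCount x y w = 0 := by
          intro w hw
          refine splitCount_eq_zero fun p hp h1 h2 => hc fun c hcx => ?_
          rw [← h1, ← h2] at hcx
          exact hu' c (hw.mem_iff.1 ((perm_of_mem_splits hp).mem_iff.2 hcx))
        rw [zero u (.refl _), zero v huv.symm]
    rcases eq_or_of_shuffleCount_eq hK hne hu' huv hsh with h1 | h1 | h1
    · exact h1
    · exact absurd (hcomm a b h1).1 hnc
    · exact absurd (hcomm b a h1).2 hnc
  -- Splitting `u` along `P` has count 1, so `v` has a splitting into trace equivalent parts. Its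
  -- first part is then the projection of `v`.
  · have h1 := h _ _ hx hy (by
      rw [← List.length_append, (List.filter_append_perm P u).length_eq])
    rw [splitCount_eq_one (P := (TraceEq comm · _)) (Q := (TraceEq comm · _)) P
      (TraceEq.refl _) (TraceEq.refl _)] at h1
    · obtain ⟨p, hpv, h2, h3⟩ := exists_of_splitCount_ne_zero
        (fun h0 => by rw [h0] at h1; simp at h1)
      have h4 := (eq_filter_of_mem_splits P hpv
        (fun c hc => (List.mem_filter.1 (h2.perm.mem_iff.1 hc)).2)
        (fun c hc => by simpa using (List.mem_filter.1 (h3.perm.mem_iff.1 hc)).2)).1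
      rw [← h4]
      exact (h2.eq_of_pair hab fun c hc => by simpa [hP] using (List.mem_filter.1 hc).2).symm
    · intro x hx c hc
      exact (List.mem_filter.1 (hx.perm.mem_iff.1 hc)).2
    · intro x hx c hc
      simpa using (List.mem_filter.1 (hx.perm.mem_iff.1 hc)).2

/-- Induction on a common length bound `N`: up to length `N`, equality under `f` is trace
equivalence, so in words of length `N + 1` the proper splitting counts for both relations agree.
`hone` and `hinj` settle words of length at most one. -/
theorem traceEq_of_map_eq [Nontrivial K] (hK : HasMiddleChoose K) {M : Type*} [Monoid M]
    (f : FreeMonoid α →* M) (hone : ∀ a, f (.of a) ≠ 1)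
    (hinj : ∀ a b, f (.of a) = f (.of b) → a = b)
    (h : ∀ u v : List α, f (.ofList u) = f (.ofList v) → ∀ X Y : M,
      ((splitCount (fun x => f (.ofList x) = X) (fun y => f (.ofList y) = Y) u : ℕ) : K) =
        (splitCount (fun x => f (.ofList x) = X) (fun y => f (.ofList y) = Y) v : ℕ))
    (huv : f (.ofList u) = f (.ofList v)) :
    TraceEq (fun a b => f (.of a) * f (.of b) = f (.of b) * f (.of a)) u v := by
  set comm : α → α → Prop := fun a b => f (.of a) * f (.of b) = f (.of b) * f (.of a) with hcomm
  obtain ⟨N, hN⟩ : ∃ N, u.length ≤ N ∧ v.length ≤ N := ⟨max u.length v.length, by simp⟩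
  induction N generalizing u v with
  | zero =>
    rw [List.length_eq_zero_iff.1 (by omega : u.length = 0),
      List.length_eq_zero_iff.1 (by omega : v.length = 0)]
    exact TraceEq.refl _
  | succ N ih =>
    have iff : ∀ x y : List α, x.length ≤ N → y.length ≤ N →
        (f (.ofList x) = f (.ofList y) ↔ TraceEq comm x y) := fun x y hx hy =>
      ⟨fun h => ih h ⟨hx, hy⟩, fun h => h.map_eq f (fun _ _ h => Eq.symm h) (fun _ _ h => h)⟩
    have count : ∀ w x y : List α, w.length ≤ N + 1 → x ≠ [] → y ≠ [] → x.length ≤ N →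
        y.length ≤ N → splitCount (fun z => f (.ofList z) = f (.ofList x))
          (fun z => f (.ofList z) = f (.ofList y)) w =
          splitCount (TraceEq comm · x) (TraceEq comm · y) w := by
      intro w x y hw hx hy hxN hyN
      refine splitCount_congr fun p hp => ?_
      have hlen := length_of_mem_splits hp
      -- Improper splittings count on neither side, because by induction no nonempty word of length
      -- at most `N` has image `1`.
      by_cases h1 : p.1 = []
      · have : ¬ TraceEq comm p.1 x := fun h => hx (by simpa [h1] using h.perm)
        simp only [this, false_and, iff_false, not_and]
        exact fun h => absurd ((iff _ _ (by simp [h1]) hxN).1 h) this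
      by_cases h2 : p.2 = []
      · have : ¬ TraceEq comm p.2 y := fun h => hy (by simpa [h2] using h.perm)
        simp only [this, and_false, iff_false, not_and]
        exact fun _ h => absurd ((iff _ _ (by simp [h2]) hyN).1 h) this
      have h1' := List.length_pos_iff.2 h1
      have h2' := List.length_pos_iff.2 h2
      rw [iff _ _ (by omega) hxN, iff _ _ (by omega) hyN]
    have main : ∀ u v : List α, u.length ≤ N + 1 → v.length ≤ N + 1 → 2 ≤ u.length →
        f (.ofList u) = f (.ofList v) → TraceEq comm u v := by
      intro u v hu hv hu2 huv
      refine traceEq_of_splitCount_eq hK hu2 ?_ ?_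
      · rintro a b ⟨rfl, rfl⟩
        have : comm a b := by
          simpa [FreeMonoid.ofList_cons] using huv
        exact ⟨this, Eq.symm this⟩
      · intro x y hx hy hxy
        have hx' := List.length_pos_iff.2 hx
        have hy' := List.length_pos_iff.2 hy
        rw [← count u x y hu hx hy (by omega) (by omega),
          ← count v x y hv hx hy (by omega) (by omega)]
        exact h u v huv _ _
    by_cases hu2 : 2 ≤ u.length
    · exact main u v hN.1 hN.2 hu2 huv
    by_cases hv2 : 2 ≤ v.length
    · exact (main v u hN.2 hN.1 hv2 huv.symm).symm
    match u, v with
    | [], [] => exact TraceEq.refl _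
    | [], [b] => exact absurd (by simpa using huv.symm) (hone b)
    | [a], [] => exact absurd (by simpa using huv) (hone a)
    | [a], [b] =>
      obtain rfl := hinj a b (by simpa using huv)
      exact TraceEq.refl _
    | _ :: _ :: _, _ => simp at hu2
    | _, _ :: _ :: _ => simp at hv2

/-! ### Coefficients of the coproduct -/

variable {A : Type u}

theorem wordCoproduct_ofList (l : List A) :
    wordCoproduct K (FreeMonoid.ofList l) = ((splits l).map fun p =>
      (single (FreeMonoid.ofList p.1, FreeMonoid.ofList p.2) 1 :
        MonoidAlgebra K (FreeMonoid A × FreeMonoid A))).sum := by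
  induction l with
  | nil => simp [splits, one_def]; rfl
  | cons a l ih =>
    rw [FreeMonoid.ofList_cons, map_mul, ih, splits, List.map_append, List.sum_append,
      List.map_map, List.map_map]
    simp only [wordCoproduct, FreeMonoid.lift_eval_of, add_mul, ← List.sum_map_mul_left]
    simp [Function.comp_def, single_mul_single]

theorem coproduct_single (w : FreeMonoid A) : coproduct K (single w 1) = wordCoproduct K w := by
  simp [coproduct]

/-- The coproduct of a word, with values in `K[A*/≡] ⊗ K[A*/≡]`. -/
noncomputable def quotientWordCoproduct (K : Type v) [Semiring K] (c : Con (FreeMonoid A)) :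
    FreeMonoid A →* MonoidAlgebra K (c.Quotient × c.Quotient) :=
  ((mapDomainRingHom K (c.mk'.prodMap c.mk')) : _ →* _).comp (wordCoproduct K)

theorem natTensorNat_wordCoproduct (c : Con (FreeMonoid A)) (w : FreeMonoid A) :
    natTensorNat K c (wordCoproduct K w) = quotientWordCoproduct K c w := rfl

/-- The dictionary between the algebra and the combinatorics of splittings. -/
theorem coeff_quotientWordCoproduct (c : Con (FreeMonoid A)) (l : List A)
    (X Y : c.Quotient) :
    (quotientWordCoproduct K c (FreeMonoid.ofList l)).coeff (X, Y) =
      (splitCount (fun x => c.mk' (.ofList x) = X) (fun y => c.mk' (.ofList y) = Y) l : ℕ) := by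
  classical
  rw [← natTensorNat_wordCoproduct, wordCoproduct_ofList, map_list_sum, List.map_map, splitCount]
  induction splits l with
  | nil => simp
  | cons p s ih =>
    rw [List.map_cons, List.sum_cons, coeff_add, Finsupp.add_apply, ih, List.countP_cons,
      Nat.cast_add, add_comm]
    congr 1
    simp only [Function.comp_apply, natTensorNat, mapDomainLinearMap_single, coeff_single,
      Finsupp.single_apply, Prod.map_apply, Prod.mk.injEq, decide_eq_true_eq, Nat.cast_ite,
      Nat.cast_one, Nat.cast_zero]

theorem IsQuotientCoproduct.apply_single {c : Con (FreeMonoid A)}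
    {d : MonoidAlgebra K c.Quotient →ₗ[K] MonoidAlgebra K (c.Quotient × c.Quotient)}
    (hd : IsQuotientCoproduct K c d) (w : FreeMonoid A) :
    d (single (c.mk' w) 1) = quotientWordCoproduct K c w := by
  have := LinearMap.congr_fun hd (single w 1)
  simpa [nat, coproduct_single, natTensorNat_wordCoproduct] using this

/-- Since the classes form a basis, `c_≡` exists precisely when its prescribed values on words
depend only on their classes. -/
theorem isShuffleCompatible_iff {c : Con (FreeMonoid A)} :
    IsShuffleCompatible K c ↔ c ≤ Con.ker (quotientWordCoproduct K c) := by
  constructor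
  · rintro ⟨d, hd⟩ x y hxy
    rw [Con.ker_rel, ← hd.apply_single, ← hd.apply_single]
    congr 2
    exact (Con.eq c).2 hxy
  · intro h
    refine ⟨Finsupp.linearCombination K (Con.lift c (quotientWordCoproduct K c) h) ∘ₗ
      (coeffLinearEquiv K).toLinearMap, ?_⟩
    refine MonoidAlgebra.lhom_ext' fun w => LinearMap.ext_ring ?_
    have : natTensorNat K c (coproduct K (single w 1)) = quotientWordCoproduct K c w := by
      rw [coproduct_single, natTensorNat_wordCoproduct]
    simp [nat, this]

end

/-! ### From compatibility to the trace monoid -/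

section

variable {α β : Type*} {A : Type u} {K : Type v}

theorem splitCount_map (f : α → β) (P Q : List β → Prop) (l : List α) :
    splitCount P Q (l.map f) = splitCount (fun x => P (x.map f)) (fun y => Q (y.map f)) l := by
  simp [splitCount, splits_map, List.countP_map, Function.comp_def]

theorem splitCount_eq_of_rel [Semiring K] {c : Con (FreeMonoid A)} (hc : IsShuffleCompatible K c)
    {u v : List A} (h : c.mk' (.ofList u) = c.mk' (.ofList v)) (X Y : c.Quotient) :
    ((splitCount (fun x => c.mk' (.ofList x) = X) (fun y => c.mk' (.ofList y) = Y) u : ℕ) : K) =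
      (splitCount (fun x => c.mk' (.ofList x) = X) (fun y => c.mk' (.ofList y) = Y) v : ℕ) := by
  rw [← coeff_quotientWordCoproduct, ← coeff_quotientWordCoproduct]
  have := isShuffleCompatible_iff.1 hc ((Con.eq c).1 h)
  rw [Con.ker_rel] at this
  rw [this]

/-- Letters congruent to `1` are discarded and congruent letters are identified, so `B` meets the
hypotheses `hone` and `hinj` of `traceEq_of_map_eq`. The section `s` transports splitting counts
from words over `A` to words over `B`. -/
theorem isPartiallyCommutative_of_hasMiddleChoose [Semiring K] [Nontrivial K]
    (hK : HasMiddleChoose K) {c : Con (FreeMonoid A)} (hc : IsShuffleCompatible K c) :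
    IsPartiallyCommutative c.Quotient := by
  let B : Type u := {m : c.Quotient // m ≠ 1 ∧ ∃ a, c.mk' (.of a) = m}
  let f : FreeMonoid B →* c.Quotient := FreeMonoid.lift Subtype.val
  choose s hs using fun b : B => b.2.2
  have hf : ∀ l : List B, f (.ofList l) = c.mk' (.ofList (l.map s)) := by
    intro l
    induction l with
    | nil => simp
    | cons b l ih =>
      rw [List.map_cons, FreeMonoid.ofList_cons, FreeMonoid.ofList_cons, map_mul, map_mul, ih, hs]
      rfl
  have hsurj : Function.Surjective f := by
    rw [← MonoidHom.mrange_eq_top, eq_top_iff]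
    rintro m -
    obtain ⟨w, rfl⟩ := Con.mk'_surjective m
    induction w using FreeMonoid.inductionOn' with
    | one => exact one_mem _
    | of_mul a w ih =>
      rw [map_mul]
      refine mul_mem ?_ ih
      by_cases h : c.mk' (.of a) = 1
      · rw [h]; exact one_mem _
      · exact ⟨.of ⟨_, h, a, rfl⟩, rfl⟩
  let θ : SimpleGraph B :=
    { Adj := fun a b => a ≠ b ∧ a.1 * b.1 = b.1 * a.1
      symm := ⟨fun a b h => ⟨h.1.symm, h.2.symm⟩⟩
      loopless := ⟨fun a h => h.1 rfl⟩ }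
  let rels : FreeMonoid B → FreeMonoid B → Prop := fun x y => ∃ a b : B, θ.Adj a b ∧
    x = FreeMonoid.of a * FreeMonoid.of b ∧ y = FreeMonoid.of b * FreeMonoid.of a
  have hrels : ∀ x y, rels x y → f x = f y := by
    rintro x y ⟨a, b, hab, rfl, rfl⟩
    rw [map_mul, map_mul]
    exact hab.2
  let g : TraceMonoid B θ →* c.Quotient := PresentedMonoid.lift Subtype.val hrels
  have hg : ∀ w, g (PresentedMonoid.mk rels w) = f w := fun w => rfl
  refine ⟨B, θ, ⟨(MulEquiv.ofBijective g ⟨?_, ?_⟩).symm⟩⟩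
  · intro x y
    refine PresentedMonoid.inductionOn₂ x y fun u v huv => ?_
    have huv' : f (.ofList u.toList) = f (.ofList v.toList) := huv
    have := traceEq_of_map_eq hK f (fun b => b.2.1) (fun a b h => Subtype.ext h) ?_ huv'
    · refine this.map_eq (PresentedMonoid.mk rels) (fun _ _ h => h.symm) fun a b hab => ?_
      rcases eq_or_ne a b with rfl | hne
      · rfl
      · rw [← map_mul, ← map_mul]
        exact PresentedMonoid.mk_eq_mk_of_rel ⟨a, b, ⟨hne, hab⟩, rfl, rfl⟩
    · intro u v huv X Y
      simp only [hf]
      have h1 := splitCount_eq_of_rel hc (u := u.map s) (v := v.map s)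
        (by rw [← hf, ← hf, huv]) X Y
      rwa [splitCount_map, splitCount_map] at h1
  · intro m
    obtain ⟨w, rfl⟩ := hsurj m
    exact ⟨PresentedMonoid.mk rels w, rfl⟩

/-! ### Layers of a congruence over a ring -/

open Classical in
theorem splitCount_eq_add_proper (P Q : List α → Prop) {l : List α} (hl : l ≠ []) :
    splitCount P Q l = (if P [] ∧ Q l then 1 else 0) + (if P l ∧ Q [] then 1 else 0) +
      splitCount (fun x => x ≠ [] ∧ P x) (fun y => y ≠ [] ∧ Q y) l := by
  have left : ∀ P Q : List α → Prop, splitCount P Q l =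
      splitCount (fun x => x = [] ∧ P x) Q l + splitCount (fun x => x ≠ [] ∧ P x) Q l := by
    intro P Q
    rw [splitCount, List.countP_eq_countP_filter_add _ _ (fun p => decide (p.1 = [])),
      List.countP_filter, List.countP_filter]
    congr 1 <;> refine List.countP_congr fun p _ => ?_ <;> simp <;> tauto
  have right : ∀ P Q : List α → Prop, splitCount P Q l =
      splitCount P (fun x => x = [] ∧ Q x) l + splitCount P (fun x => x ≠ [] ∧ Q x) l := by
    intro P Q
    rw [splitCount, List.countP_eq_countP_filter_add _ _ (fun p => decide (p.2 = [])),
      List.countP_filter, List.countP_filter]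
    congr 1 <;> refine List.countP_congr fun p _ => ?_ <;> simp <;> tauto
  have hleft : splitCount (fun x => x = [] ∧ P x) Q l = if P [] ∧ Q l then 1 else 0 := by
    split_ifs with h
    · rw [← shuffleCount_nil_left l]
      refine splitCount_congr fun p hp => ⟨fun h' => ⟨h'.1.1, ?_⟩, fun h' => ?_⟩
      · simpa using (eq_filter_of_mem_splits (fun _ => false) hp (by simp [h'.1.1]) (by simp)).2
      · rw [h'.1, h'.2]; exact ⟨⟨rfl, h.1⟩, h.2⟩
    · refine splitCount_eq_zero fun p hp h1 h2 => h ⟨h1.1 ▸ h1.2, ?_⟩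
      have := (eq_filter_of_mem_splits (fun _ => false) hp (by simp [h1.1]) (by simp)).2
      simp only [Bool.not_false, List.filter_true] at this
      rwa [← this]
  have hright : splitCount (fun x => x ≠ [] ∧ P x) (fun y => y = [] ∧ Q y) l =
      if P l ∧ Q [] then 1 else 0 := by
    split_ifs with h
    · have h1 := shuffleCount_filter (fun _ => true) l
      simp only [Bool.not_true, List.filter_true, List.filter_false] at h1
      rw [← h1]
      refine splitCount_congr fun p hp => ⟨fun h' => ⟨?_, h'.2.1⟩, fun h' => ?_⟩
      · simpa using (eq_filter_of_mem_splits (fun _ => true) hp (by simp) (by simp [h'.2.1])).1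
      · rw [h'.1, h'.2]; exact ⟨⟨hl, h.1⟩, rfl, h.2⟩
    · refine splitCount_eq_zero fun p hp h1 h2 => h ⟨?_, h2.1 ▸ h2.2⟩
      have := (eq_filter_of_mem_splits (fun _ => true) hp (by simp) (by simp [h2.1])).1
      simp only [List.filter_true] at this
      rw [← this]
      exact h1.2
  rw [left, hleft, right, hright, add_assoc]

/-- The pairs of congruent words of length at most `N` in the letters from `A₀`. -/
def boundedRel (c : Con (FreeMonoid A)) (A₀ : Set A) (N : ℕ) :
    Set (FreeMonoid A × FreeMonoid A) :=
  {p | c p.1 p.2 ∧ ((∀ a ∈ p.1.toList, a ∈ A₀) ∧ p.1.toList.length ≤ N) ∧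
    ((∀ a ∈ p.2.toList, a ∈ A₀) ∧ p.2.toList.length ≤ N)}

theorem finite_boundedRel (c : Con (FreeMonoid A)) {A₀ : Set A} (hA : A₀.Finite) (N : ℕ) :
    (boundedRel c A₀ N).Finite := by
  have := hA.to_subtype
  have h : {l : FreeMonoid A | (∀ a ∈ l.toList, a ∈ A₀) ∧ l.toList.length ≤ N}.Finite := by
    refine ((List.finite_length_le A₀ N).image
      (fun l => FreeMonoid.ofList (l.map Subtype.val))).subset ?_
    rintro l ⟨h1, h2⟩
    lift l.toList to List A₀ using h1 with l' hl'
    exact ⟨l', by simpa using h2, hl'⟩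
  exact (h.prod h).subset fun p hp => ⟨hp.2.1, hp.2.2⟩

theorem relatorCon_boundedRel_le (c : Con (FreeMonoid A)) (A₀ : Set A) (N : ℕ) :
    relatorCon (boundedRel c A₀ N) ≤ c :=
  Con.conGen_le.2 fun _ _ h => h.1

theorem mapDomain_quotientWordCoproduct [Semiring K] {d e : Con (FreeMonoid A)} (h : d ≤ e)
    (w : FreeMonoid A) :
    mapDomainRingHom K ((d.map e h).prodMap (d.map e h)) (quotientWordCoproduct K d w) =
      quotientWordCoproduct K e w := by
  have : ((mapDomainRingHom K ((d.map e h).prodMap (d.map e h)) : _ →* _).comp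
      (quotientWordCoproduct K d)) = quotientWordCoproduct K e := by
    refine FreeMonoid.hom_eq fun a => ?_
    simp [quotientWordCoproduct, wordCoproduct, mapDomain_add]
    rfl
  exact DFunLike.congr_fun this w

section Ring

variable [Ring K] [Nontrivial K] {c : Con (FreeMonoid A)}

/-- A shortest nonempty word congruent to `1` would have coefficient 2 at `1 ⊗ 1`, against 1 for the
empty word. In a ring this forces `1 = 0`. -/
theorem eq_nil_of_mk_eq_one (hc : IsShuffleCompatible K c) {u : List A}
    (h : c.mk' (.ofList u) = 1) : u = [] := by
  induction hn : u.length using Nat.strong_induction_on generalizing u with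
  | _ n ih =>
    by_contra hu
    have h1 := splitCount_eq_of_rel hc (u := u) (v := []) (by simpa using h) 1 1
    rw [splitCount_eq_add_proper _ _ hu, splitCount_nil_of _ _ (by simp),
      splitCount_eq_zero (l := u)] at h1
    · simp only [h, map_one, FreeMonoid.ofList_nil, and_self, if_true, add_zero, Nat.reduceAdd,
        Nat.cast_ofNat, Nat.cast_one, ← one_add_one_eq_two (R := K), add_eq_left] at h1
      exact one_ne_zero h1
    · rintro p hp ⟨hp1, h1⟩ ⟨hp2, -⟩
      have := length_of_mem_splits hp
      have := List.length_pos_iff.2 hp2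
      exact hp1 (ih p.1.length (by omega) h1 rfl)

/-- On the proper subwords involved, `d` and `c` coincide, so proper counts for `d` become counts
for `c`, which compatibility equates. The latter contain no improper splittings, since nonempty
words are not congruent to `1`. -/
theorem proper_splitCount_eq (hc : IsShuffleCompatible K c) {A₀ : Set A} {N : ℕ} {u v : List A}
    (h : (FreeMonoid.ofList u, FreeMonoid.ofList v) ∈ boundedRel c A₀ (N + 1))
    {d : Con (FreeMonoid A)} (hd : d = relatorCon (boundedRel c A₀ N)) (X Y : d.Quotient) :
    ((splitCount (fun x => x ≠ [] ∧ d.mk' (.ofList x) = X)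
      (fun y => y ≠ [] ∧ d.mk' (.ofList y) = Y) u : ℕ) : K) =
    (splitCount (fun x => x ≠ [] ∧ d.mk' (.ofList x) = X)
      (fun y => y ≠ [] ∧ d.mk' (.ofList y) = Y) v : ℕ) := by
  have hdc : d ≤ c := hd.trans_le (relatorCon_boundedRel_le c A₀ N)
  have hof : ∀ p ∈ boundedRel c A₀ N, d p.1 p.2 := fun p hp => hd ▸ ConGen.Rel.of _ _ hp
  obtain ⟨huv, ⟨hu, hul⟩, hv, hvl⟩ := h
  simp only [FreeMonoid.toList_ofList] at hu hul hv hvl huv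
  have bounds : ∀ w : List A, (∀ a ∈ w, a ∈ A₀) → w.length ≤ N + 1 → ∀ p ∈ splits w,
      p.1 ≠ [] → p.2 ≠ [] → ((∀ a ∈ p.1, a ∈ A₀) ∧ p.1.length ≤ N) ∧
        ((∀ a ∈ p.2, a ∈ A₀) ∧ p.2.length ≤ N) := by
    intro w hw hwl p hp h1 h2
    have h1 := List.length_pos_iff.2 h1
    have h2 := List.length_pos_iff.2 h2
    have h3 := length_of_mem_splits hp
    have h4 := subset_of_mem_splits hp
    exact ⟨⟨fun a ha => hw a (h4.1 a ha), by omega⟩, fun a ha => hw a (h4.2 a ha), by omega⟩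
  have main : ∀ w : List A, (∀ a ∈ w, a ∈ A₀) → w.length ≤ N + 1 → ∀ p ∈ splits w,
      p.1 ≠ [] → p.2 ≠ [] → d.mk' (.ofList p.1) = X → d.mk' (.ofList p.2) = Y →
      ∀ w' : List A, (∀ a ∈ w', a ∈ A₀) → w'.length ≤ N + 1 →
      splitCount (fun x => x ≠ [] ∧ d.mk' (.ofList x) = X)
        (fun y => y ≠ [] ∧ d.mk' (.ofList y) = Y) w' =
      splitCount (fun x => c.mk' (.ofList x) = c.mk' (.ofList p.1))
        (fun y => c.mk' (.ofList y) = c.mk' (.ofList p.2)) w' := by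
    rintro w hw hwl p hp hp1 hp2 rfl rfl w' hw' hwl'
    have hb := bounds w hw hwl p hp hp1 hp2
    refine splitCount_congr fun q hq => ⟨fun ⟨⟨_, h1⟩, _, h2⟩ => ⟨?_, ?_⟩, fun ⟨h1, h2⟩ => ?_⟩
    · exact (Con.eq c).2 (hdc ((Con.eq d).1 h1))
    · exact (Con.eq c).2 (hdc ((Con.eq d).1 h2))
    · have hq1 : q.1 ≠ [] := by
        intro h0
        rw [h0] at h1
        exact hp1 (eq_nil_of_mk_eq_one hc (by simpa using h1.symm))
      have hq2 : q.2 ≠ [] := by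
        intro h0
        rw [h0] at h2
        exact hp2 (eq_nil_of_mk_eq_one hc (by simpa using h2.symm))
      have hb' := bounds w' hw' hwl' q hq hq1 hq2
      exact ⟨⟨hq1, (Con.eq d).2 (hof (_, _) ⟨(Con.eq c).1 h1, hb'.1, hb.1⟩)⟩,
        hq2, (Con.eq d).2 (hof (_, _) ⟨(Con.eq c).1 h2, hb'.2, hb.2⟩)⟩
  have huv' := splitCount_eq_of_rel hc ((Con.eq c).2 huv)
  -- Comparison with `c` needs short words representing `X` and `Y`; a splitting of `u` or of `v`
  -- supplies them, and without any both counts are zero.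
  by_cases h1 : splitCount (fun x => x ≠ [] ∧ d.mk' (.ofList x) = X)
      (fun y => y ≠ [] ∧ d.mk' (.ofList y) = Y) u = 0
  · by_cases h2 : splitCount (fun x => x ≠ [] ∧ d.mk' (.ofList x) = X)
      (fun y => y ≠ [] ∧ d.mk' (.ofList y) = Y) v = 0
    · rw [h1, h2]
    · obtain ⟨p, hp, ⟨hp1, hX⟩, hp2, hY⟩ := exists_of_splitCount_ne_zero h2
      have hm := main v hv hvl p hp hp1 hp2 hX hY
      rw [hm u hu hul, hm v hv hvl]
      exact huv' _ _
  · obtain ⟨p, hp, ⟨hp1, hX⟩, hp2, hY⟩ := exists_of_splitCount_ne_zero h1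
    have hm := main u hu hul p hp hp1 hp2 hX hY
    rw [hm u hu hul, hm v hv hvl]
    exact huv' _ _

/-- Congruent words of length at most `N + 1` have coproducts that differ in the primitive terms
only, modulo the congruence generated by the pairs of words of length at most `N`. -/
theorem quotientWordCoproduct_add_eq (hc : IsShuffleCompatible K c) {A₀ : Set A} {N : ℕ}
    {x y : FreeMonoid A} (h : (x, y) ∈ boundedRel c A₀ (N + 1)) :
    let d := relatorCon (boundedRel c A₀ N)
    quotientWordCoproduct K d x + (single (d.mk' y, 1) 1 + single (1, d.mk' y) 1) =
      quotientWordCoproduct K d y + (single (d.mk' x, 1) 1 + single (1, d.mk' x) 1) := by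
  classical
  intro d
  obtain ⟨u, rfl⟩ := FreeMonoid.ofList.surjective x
  obtain ⟨v, rfl⟩ := FreeMonoid.ofList.surjective y
  have huv : c.mk' (.ofList u) = c.mk' (.ofList v) := (Con.eq c).2 h.1
  by_cases hu : u = []
  · have hv : v = [] := eq_nil_of_mk_eq_one hc (by rw [← huv, hu]; simp)
    rw [hu, hv]
  have hv : v ≠ [] := by
    rintro rfl
    exact hu (eq_nil_of_mk_eq_one hc (by simpa using huv))
  ext ⟨X, Y⟩
  simp only [coeff_add, Finsupp.add_apply, coeff_quotientWordCoproduct, coeff_single,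
    Finsupp.single_apply, Prod.mk.injEq]
  rw [splitCount_eq_add_proper _ _ hu, splitCount_eq_add_proper _ _ hv]
  simp only [Nat.cast_add, Nat.cast_ite, Nat.cast_one, Nat.cast_zero, FreeMonoid.ofList_nil,
    map_one]
  rw [proper_splitCount_eq hc h rfl X Y]
  abel

theorem isShuffleCompatible_relatorCon_boundedRel (hc : IsShuffleCompatible K c) (A₀ : Set A)
    (N : ℕ) : IsShuffleCompatible K (relatorCon (boundedRel c A₀ N)) := by
  rw [isShuffleCompatible_iff]
  cases N with
  | zero =>
    refine Con.conGen_le.2 fun x y h => ?_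
    have hx : x = 1 := List.length_eq_zero_iff.1 (Nat.le_zero.1 h.2.1.2)
    have hy : y = 1 := List.length_eq_zero_iff.1 (Nat.le_zero.1 h.2.2.2)
    rw [hx, hy]
    exact Con.refl _ _
  | succ N =>
    have hle : relatorCon (boundedRel c A₀ N) ≤ relatorCon (boundedRel c A₀ (N + 1)) :=
      Con.conGen_mono fun x y h => ⟨h.1, ⟨h.2.1.1, h.2.1.2.trans N.le_succ⟩,
        h.2.2.1, h.2.2.2.trans N.le_succ⟩
    refine Con.conGen_le.2 fun x y h => ?_
    rw [Con.ker_rel]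
    -- Push the identity modulo the previous layer into the quotient where `x` and `y` become equal;
    -- the primitive terms then cancel.
    have h1 := congrArg (mapDomainRingHom K (((relatorCon (boundedRel c A₀ N)).map _ hle).prodMap
      ((relatorCon (boundedRel c A₀ N)).map _ hle))) (quotientWordCoproduct_add_eq hc h)
    have h2 : (relatorCon (boundedRel c A₀ (N + 1))).mk' x =
        (relatorCon (boundedRel c A₀ (N + 1))).mk' y := (Con.eq _).2 (ConGen.Rel.of _ _ h)
    simp only [map_add, mapDomain_quotientWordCoproduct] at h1
    have h3 : ∀ w, (relatorCon (boundedRel c A₀ N)).map _ hle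
        ((relatorCon (boundedRel c A₀ N)).mk' w) =
        (relatorCon (boundedRel c A₀ (N + 1))).mk' w := fun w => rfl
    simp only [mapDomainRingHom_apply, mapDomain_single, MonoidHom.coe_prodMap, Prod.map_apply,
      map_one, h3, h2] at h1
    exact add_right_cancel h1

theorem isPrimitive_sub (hc : IsShuffleCompatible K c) {A₀ : Set A} {N : ℕ}
    {x y : FreeMonoid A} (h : (x, y) ∈ boundedRel c A₀ (N + 1)) :
    IsPrimitive K (relatorCon (boundedRel c A₀ N)) (nat K _ (single x 1 - single y 1)) := by
  obtain ⟨d, hd⟩ := isShuffleCompatible_relatorCon_boundedRel hc A₀ N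
  refine ⟨d, hd, ?_⟩
  have key := quotientWordCoproduct_add_eq hc h
  simp only at key
  have hnat : nat K (relatorCon (boundedRel c A₀ N)) (single x 1 - single y 1) =
      single ((relatorCon (boundedRel c A₀ N)).mk' x) 1 -
        single ((relatorCon (boundedRel c A₀ N)).mk' y) 1 := by
    rw [map_sub]
    simp [nat]
  have hmap : ∀ (f : (relatorCon (boundedRel c A₀ N)).Quotient →
      (relatorCon (boundedRel c A₀ N)).Quotient × (relatorCon (boundedRel c A₀ N)).Quotient) P Q,
      mapDomain f (P - Q : MonoidAlgebra K _) = mapDomain f P - mapDomain f Q := fun f P Q =>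
    map_sub (mapDomainLinearMap K K f) P Q
  rw [hnat, map_sub, hd.apply_single, hd.apply_single, hmap, hmap]
  simp only [mapDomain_single]
  rw [← sub_eq_zero] at key ⊢
  rw [← key]
  abel

theorem exists_isPrimitivePartition (hc : IsShuffleCompatible K c) (hfg : IsFinitelyGenerated c) :
    ∃ (R : Set (FreeMonoid A × FreeMonoid A)) (n : ℕ)
      (S : Fin n → Set (FreeMonoid A × FreeMonoid A)), IsPrimitivePartition K c R S := by
  obtain ⟨R₀, hR₀, rfl⟩ := hfg
  set c := relatorCon R₀ with hcdef
  let A₀ : Set A := ⋃ p ∈ R₀, {a | a ∈ p.1.toList ∨ a ∈ p.2.toList}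
  have hA₀ : A₀.Finite := by
    refine hR₀.biUnion fun p _ => ?_
    exact (List.finite_toSet p.1.toList).union (List.finite_toSet p.2.toList)
  have hmem : ∀ p ∈ R₀, (∀ a ∈ p.1.toList, a ∈ A₀) ∧ ∀ a ∈ p.2.toList, a ∈ A₀ := fun p hp =>
    ⟨fun a ha => Set.mem_biUnion hp (Or.inl ha), fun a ha => Set.mem_biUnion hp (Or.inr ha)⟩
  -- Every layer must be nonempty, so without letters there must be no layer at all.
  obtain ⟨n, hn, hn0⟩ : ∃ n, (∀ p ∈ R₀, p.1.toList.length ≤ n ∧ p.2.toList.length ≤ n) ∧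
      (0 < n → A₀.Nonempty) := by
    rcases A₀.eq_empty_or_nonempty with h0 | h0
    · refine ⟨0, fun p hp => ?_, fun h => absurd h (lt_irrefl 0)⟩
      have := hmem p hp
      simp only [h0, Set.mem_empty_iff_false, imp_false] at this
      rw [List.eq_nil_iff_forall_not_mem.2 this.1, List.eq_nil_iff_forall_not_mem.2 this.2]
      simp
    · obtain ⟨n, hn⟩ := (hR₀.image fun p => max p.1.toList.length p.2.toList.length).bddAbove
      refine ⟨n, fun p hp => ?_, fun _ => h0⟩
      exact max_le_iff.1 (hn (Set.mem_image_of_mem _ hp))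
  -- Layers by exact maximal length, hence disjoint. Length 0 is omitted, since its only pair is the
  -- trivial `(1, 1)`.
  let S : ℕ → Set (FreeMonoid A × FreeMonoid A) := fun i =>
    {p ∈ boundedRel c A₀ (i + 1) | max p.1.toList.length p.2.toList.length = i + 1}
  have hS : ∀ i N, i < N → S i ⊆ boundedRel c A₀ N := fun i N hi p hp =>
    ⟨hp.1.1, ⟨hp.1.2.1.1, hp.1.2.1.2.trans hi⟩, hp.1.2.2.1, hp.1.2.2.2.trans hi⟩
  have hgen : ∀ N (U : Set (FreeMonoid A × FreeMonoid A)), U ⊆ boundedRel c A₀ N →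
      (∀ i < N, S i ⊆ U) → relatorCon U = relatorCon (boundedRel c A₀ N) := by
    intro N U h1 h2
    refine le_antisymm (Con.conGen_mono fun x y h => h1 h) (Con.conGen_le.2 fun x y h => ?_)
    by_cases h0 : max x.toList.length y.toList.length = 0
    · have hx : x = 1 := List.length_eq_zero_iff.1 (by
        exact Nat.le_zero.1 (h0 ▸ le_max_left _ _))
      have hy : y = 1 := List.length_eq_zero_iff.1 (by
        exact Nat.le_zero.1 (h0 ▸ le_max_right _ _))
      rw [hx, hy]
      exact Con.refl _ _
    · obtain ⟨i, hi⟩ := Nat.exists_eq_succ_of_ne_zero h0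
      have hiN : i < N := Nat.lt_of_succ_le (hi ▸ max_le h.2.1.2 h.2.2.2)
      exact ConGen.Rel.of _ _ (h2 i hiN
        ⟨⟨h.1, ⟨h.2.1.1, (le_max_left _ _).trans hi.le⟩, h.2.2.1, (le_max_right _ _).trans hi.le⟩, hi⟩)
  refine ⟨⋃ i : Fin n, S i.1, n, fun i => S i.1, ?_, ?_, ?_, ?_, rfl, ?_⟩
  · exact (finite_boundedRel c hA₀ n).subset (Set.iUnion_subset fun i => hS i n i.2)
  · rw [hgen n (⋃ i : Fin n, S i.1) (Set.iUnion_subset fun i => hS i n i.2)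
      fun i hi => Set.subset_iUnion (fun i : Fin n => S i.1) ⟨i, hi⟩]
    refine le_antisymm (relatorCon_boundedRel_le c A₀ n) (Con.conGen_mono fun x y h => ?_)
    exact ⟨ConGen.Rel.of _ _ h, ⟨(hmem _ h).1, (hn _ h).1⟩, (hmem _ h).2, (hn _ h).2⟩
  · intro i
    obtain ⟨a, ha⟩ := hn0 (Nat.zero_lt_of_lt i.2)
    have h1 : (∀ b ∈ replicate ((i : ℕ) + 1) a, b ∈ A₀) ∧
        (replicate ((i : ℕ) + 1) a).length ≤ i + 1 :=
      ⟨fun b hb => List.eq_of_mem_replicate hb ▸ ha, by simp⟩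
    -- A trivial pair of equal words keeps the layer nonempty.
    refine ⟨(.ofList (replicate ((i : ℕ) + 1) a), .ofList (replicate ((i : ℕ) + 1) a)),
      ⟨c.refl _, h1, h1⟩, by simp⟩
  · intro i j hij
    refine Set.disjoint_left.2 fun p hp hp' => hij (Fin.ext ?_)
    have := hp.2.symm.trans hp'.2
    omega
  · intro i x y hxy
    rw [hgen i (⋃ j, ⋃ (_ : j < i), S j) (Set.iUnion₂_subset fun j hj => hS j i hj)
      fun j hj => Set.subset_iUnion₂_of_subset (⟨j, hj.trans i.2⟩ : Fin n) hj subset_rfl]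
    exact isPrimitive_sub hc hxy.1

end Ring

end

end Shuffle

theorem theorem1 {A : Type u} (c : Con (FreeMonoid A)) (hc : Shuffle.IsFinitelyGenerated c) :
    (∀ (K : Type v) [Semiring K] [Nontrivial K], Shuffle.IsShuffleCompatible K c →
      (¬ Shuffle.IsRing K ∨ ¬ (ringChar K).Prime) →
        Shuffle.IsPartiallyCommutative c.Quotient) ∧
    (∀ (K : Type v) [Ring K] (p : ℕ), p.Prime → CharP K p → Shuffle.IsShuffleCompatible K c →
      ∃ (R : Set (FreeMonoid A × FreeMonoid A)) (n : ℕ)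
        (S : Fin n → Set (FreeMonoid A × FreeMonoid A)),
        Shuffle.IsPrimitivePartition K c R S) := by
  refine ⟨fun K _ _ h hK => ?_, fun K _ p hp _ h => ?_⟩
  · exact Shuffle.isPartiallyCommutative_of_hasMiddleChoose (Shuffle.hasMiddleChoose hK) h
  · have : Nontrivial K := CharP.nontrivial_of_char_ne_one (R := K) hp.ne_one
    exact Shuffle.exists_isPrimitivePartition h hc
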